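/- Let $q$ be a complex number with $|q|<1$. For $a\in\mathbb C$ and $n\in\mathbb N=\{0,1,2,\dots\}$ put $(a;q)_n=\prod_{k=0}^{n-1}(1-aq^k)$ (so $(a;q)_0=1$) and $(a;q)_\infty=\prod_{k=0}^{\infty}(1-aq^k)=\lim_{n\to\infty}(a;q)_n$. Then all the series below converge, and (i) $$\sum_{n=0}^\infty q^{2n(n+1)}\,\bigl(1+q^{2n+2}-2q^{4n+3}\bigr)\,\frac{(q^2;q^2)_n^3}{(q;q^2)_{n+1}^3\,(-1;q)_{2n+3}}=\frac12\sum_{n=0}^\infty\frac{q^{2n}}{(1-q^{2n+1})^2};$$ (ii) $$\sum_{n=0}^\infty q^{n(n+1)/2}\,\frac{1-q^{3n+2}}{1-q}\cdot\frac{(q;q)_n^3\,(-q;q)_n}{(q^3;q^2)_n^3}=(1-q)^2\,\frac{(q^2;q^2)_\infty^4}{(q;q^2)_\infty^4}.$$ -/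

import Mathlib

/-- The finite `q`-shifted factorial `(a;q)_n = ∏_{k=0}^{n-1} (1 - a q^k)`. -/
def qPoch (a q : ℂ) (n : ℕ) : ℂ :=
  ∏ k ∈ Finset.range n, (1 - a * q ^ k)

/-- The infinite `q`-shifted factorial `(a;q)_∞ = ∏_{k=0}^∞ (1 - a q^k)`, for `|q| < 1`. -/
noncomputable def qPochInf (a q : ℂ) : ℂ :=
  ∏' k : ℕ, (1 - a * q ^ k)

/-- For `|q| < 1` the infinite product converges, and `(a;q)_∞` is the limit of `(a;q)_n`. -/
theorem tendsto_qPoch (a q : ℂ) (hq : ‖q‖ < 1) :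
    Filter.Tendsto (fun n : ℕ => qPoch a q n) Filter.atTop (nhds (qPochInf a q)) := by
  have hs : Summable fun k : ℕ => ‖-(a * q ^ k)‖ := by
    simpa [norm_mul, norm_pow] using
      (summable_geometric_of_lt_one (norm_nonneg q) hq).mul_left ‖a‖
  have hm : Multipliable fun k : ℕ => (1 - a * q ^ k) := by
    simpa [sub_eq_add_neg] using multipliable_one_add_of_summable hs
  exact hm.hasProd.tendsto_prod_nat

/-!
Both identities come from telescoping relations between a series and the same series with one
parameter shifted, iterated until the parameter tends to `0`; the limit is taken termwise by
dominated convergence, using uniform bounds above and below for the finite products `(a;p)_n`.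

For the Lambert series, put
`G(y,n) = y^{2n+1} q^{2n(n+1)} (q²;q²)_n³ / ((yq;q²)_{n+1}² (q;q²)_n (-q;q)_{2n})`.
It has a Wilf–Zeilberger partner `F(y,n)` with `F(y,n) - F(yq²,n) = G(y,n) - G(y,n+1)`, so the sum
`S(y) = ∑ₙ F(y,n)` satisfies `S(y) - S(yq²) = G(y,0) = y / (1 - yq)²`. Since `S(0) = 0`, summing
over `y = 1, q², q⁴, …` gives `S(1) = ∑ₖ q^{2k} / (1 - q^{2k+1})²`, and `S(1)` is twice the series
to be evaluated (`summable_and_tsum_lambert`).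

The product formula is the case `a = q²`, `b = c = q` of Rahman's quadratic summation. It is reached
through a chain of four families, each of which satisfies a first-order contiguous relation
`c(A) S(A) = d(A) S(Ap)` with a closed-form telescoping certificate, and each of which at `A = 0` is
the next family at `A = 1`: `summable_and_tsum_quadratic`, `tsum_triangle_mul_qPoch_div`,
`tsum_triangle`, `tsum_triangle_div_qPoch`. The iteration is `tsum_mul_eq_of_contiguous`. Each step
contributes an infinite product, and `(-q;q)_∞ (q;q²)_∞ = 1` brings the result to the stated form.
-/

open Filter Topology

/-! ### Shifted factorials: recurrences, limits and uniform bounds -/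

@[simp]
lemma qPoch_zero (a q : ℂ) : qPoch a q 0 = 1 := by simp [qPoch]

@[simp]
lemma qPoch_zero_left (q : ℂ) (n : ℕ) : qPoch 0 q n = 1 := by simp [qPoch]

lemma qPoch_succ (a q : ℂ) (n : ℕ) : qPoch a q (n + 1) = qPoch a q n * (1 - a * q ^ n) := by
  simp [qPoch, Finset.prod_range_succ]

lemma qPoch_succ' (a q : ℂ) (n : ℕ) : qPoch a q (n + 1) = (1 - a) * qPoch (a * q) q n := by
  simp only [qPoch, Finset.prod_range_succ']
  rw [mul_comm]
  simp [pow_succ', mul_assoc]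

@[fun_prop]
lemma continuous_qPoch (q : ℂ) (n : ℕ) : Continuous fun a : ℂ => qPoch a q n := by
  unfold qPoch
  fun_prop

lemma norm_pow_lt_one {q : ℂ} (hq : ‖q‖ < 1) {n : ℕ} (hn : n ≠ 0) : ‖q ^ n‖ < 1 := by
  rw [norm_pow]
  exact pow_lt_one₀ (norm_nonneg _) hq hn

lemma norm_pow_le_self {q : ℂ} (hq : ‖q‖ < 1) {n : ℕ} (hn : n ≠ 0) : ‖q ^ n‖ ≤ ‖q‖ := by
  rw [norm_pow]
  exact pow_le_of_le_one (norm_nonneg _) hq.le hn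

lemma one_sub_ne_zero_of_norm_lt {z : ℂ} (hz : ‖z‖ < 1) : 1 - z ≠ 0 := by
  intro h
  rw [← sub_eq_zero.1 h] at hz
  simp at hz

lemma norm_mul_le_of_le_one {A z : ℂ} {r : ℝ} (hA : ‖A‖ ≤ 1) (hz : ‖z‖ ≤ r) : ‖A * z‖ ≤ r := by
  rw [norm_mul]
  exact (mul_le_of_le_one_left (norm_nonneg _) hA).trans hz

/-- The finite products `(a;p)_n` with `‖a‖ ≤ 1` and `‖p‖ ≤ r < 1` are uniformly bounded. -/
lemma exists_norm_qPoch_le {r : ℝ} (h0 : 0 ≤ r) (h1 : r < 1) :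
    ∃ M : ℝ, 0 < M ∧ ∀ a p : ℂ, ∀ n : ℕ, ‖a‖ ≤ 1 → ‖p‖ ≤ r → ‖qPoch a p n‖ ≤ M := by
  refine ⟨Real.exp (∑' k : ℕ, r ^ k), Real.exp_pos _, fun a p n ha hp => ?_⟩
  have hs := summable_geometric_of_lt_one h0 h1
  calc ‖qPoch a p n‖ ≤ ∏ k ∈ Finset.range n, Real.exp (r ^ k) := by
        rw [qPoch, norm_prod]
        refine Finset.prod_le_prod (fun _ _ => norm_nonneg _) fun k _ => ?_
        have h2 : ‖a * p ^ k‖ ≤ r ^ k :=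
          norm_mul_le_of_le_one ha (by rw [norm_pow]; gcongr)
        have h3 := Real.add_one_le_exp (r ^ k)
        have h4 := norm_sub_le (1 : ℂ) (a * p ^ k)
        rw [norm_one] at h4
        linarith
    _ = Real.exp (∑ k ∈ Finset.range n, r ^ k) := (Real.exp_sum _ _).symm
    _ ≤ _ := Real.exp_le_exp.2 (hs.sum_le_tsum _ fun k _ => pow_nonneg h0 k)

/-- The finite products `(a;p)_n` with `‖a‖, ‖p‖ ≤ r < 1` are uniformly bounded away from `0`. -/
lemma exists_le_norm_qPoch {r : ℝ} (h0 : 0 ≤ r) (h1 : r < 1) :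
    ∃ δ : ℝ, 0 < δ ∧ ∀ a p : ℂ, ∀ n : ℕ, ‖a‖ ≤ r → ‖p‖ ≤ r → δ ≤ ‖qPoch a p n‖ := by
  -- `log (1 - x) ≥ - x / (1 - x) ≥ - x / (1 - r)` for `0 ≤ x ≤ r` bounds each factor below.
  refine ⟨Real.exp (-∑' k : ℕ, r ^ k / (1 - r)), Real.exp_pos _, fun a p n ha hp => ?_⟩
  have hs : Summable fun k : ℕ => r ^ k / (1 - r) :=
    (summable_geometric_of_lt_one h0 h1).div_const _
  have hr : 0 < 1 - r := by linarith
  calc Real.exp (-∑' k : ℕ, r ^ k / (1 - r))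
      ≤ Real.exp (∑ k ∈ Finset.range n, -(r ^ k / (1 - r))) := by
        rw [Real.exp_le_exp, Finset.sum_neg_distrib, neg_le_neg_iff]
        exact hs.sum_le_tsum _ fun k _ => by positivity
    _ = ∏ k ∈ Finset.range n, Real.exp (-(r ^ k / (1 - r))) := Real.exp_sum _ _
    _ ≤ ‖qPoch a p n‖ := by
        rw [qPoch, norm_prod]
        refine Finset.prod_le_prod (fun _ _ => (Real.exp_pos _).le) fun k _ => ?_
        have h2 : ‖a * p ^ k‖ ≤ r * r ^ k := by
          rw [norm_mul, norm_pow]; gcongr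
        have h4 := norm_sub_norm_le (1 : ℂ) (a * p ^ k)
        rw [norm_one] at h4
        have h5 : r ^ k ≤ 1 := pow_le_one₀ h0 h1.le
        have h6 : 0 ≤ r ^ k := pow_nonneg h0 k
        have h7 : 0 < 1 - r * r ^ k := by nlinarith
        refine le_trans ?_ (show 1 - r * r ^ k ≤ _ by linarith)
        have h8 : (1 - r * r ^ k)⁻¹ ≤ Real.exp (r ^ k / (1 - r)) := by
          refine le_trans ?_ (Real.add_one_le_exp _)
          rw [inv_le_iff_one_le_mul₀ h7, div_add_one hr.ne', div_mul_eq_mul_div, le_div_iff₀ hr]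
          nlinarith [mul_nonneg h6 (sub_nonneg.2 h5), mul_nonneg h6 hr.le,
            mul_nonneg (mul_nonneg h6 h0) (sub_nonneg.2 h5)]
        rw [Real.exp_neg]
        exact inv_le_of_inv_le₀ h7 h8

lemma qPoch_ne_zero {a p : ℂ} (ha : ‖a‖ < 1) (hp : ‖p‖ < 1) (n : ℕ) : qPoch a p n ≠ 0 := by
  obtain ⟨δ, hδ, h⟩ := exists_le_norm_qPoch (r := max ‖a‖ ‖p‖)
    ((norm_nonneg a).trans (le_max_left _ _)) (max_lt ha hp)
  exact norm_pos_iff.1 (hδ.trans_le (h a p n (le_max_left _ _) (le_max_right _ _)))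

lemma qPochInf_ne_zero {a p : ℂ} (ha : ‖a‖ < 1) (hp : ‖p‖ < 1) : qPochInf a p ≠ 0 := by
  obtain ⟨δ, hδ, h⟩ := exists_le_norm_qPoch (r := max ‖a‖ ‖p‖)
    ((norm_nonneg a).trans (le_max_left _ _)) (max_lt ha hp)
  refine norm_pos_iff.1 (hδ.trans_le ?_)
  exact ge_of_tendsto' (tendsto_qPoch a p hp).norm fun n =>
    h a p n (le_max_left _ _) (le_max_right _ _)

lemma qPochInf_eq_mul {a p : ℂ} (hp : ‖p‖ < 1) : qPochInf a p = (1 - a) * qPochInf (a * p) p := by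
  refine tendsto_nhds_unique ((tendsto_qPoch a p hp).comp (tendsto_add_atTop_nat 1)) ?_
  simpa only [Function.comp_def, qPoch_succ'] using (tendsto_qPoch (a * p) p hp).const_mul (1 - a)

lemma qPoch_mul_qPoch_neg (q : ℂ) (n : ℕ) :
    qPoch q q n * qPoch (-q) q n = qPoch (q ^ 2) (q ^ 2) n := by
  simp only [qPoch, ← Finset.prod_mul_distrib]
  refine Finset.prod_congr rfl fun k _ => ?_
  ring

lemma qPoch_two_mul (q : ℂ) (n : ℕ) :
    qPoch q q (2 * n) = qPoch q (q ^ 2) n * qPoch (q ^ 2) (q ^ 2) n := by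
  induction n with
  | zero => simp
  | succ n ih =>
    rw [show 2 * (n + 1) = 2 * n + 1 + 1 by ring, qPoch_succ, qPoch_succ, ih, qPoch_succ, qPoch_succ]
    ring

/-- Euler's identity `(-q;q)_∞ (q;q²)_∞ = 1`. -/
lemma qPochInf_neg_mul {q : ℂ} (hq : ‖q‖ < 1) : qPochInf (-q) q * qPochInf q (q ^ 2) = 1 := by
  have hq2 : ‖q ^ 2‖ < 1 := norm_pow_lt_one hq two_ne_zero
  have h1 : qPochInf q q * qPochInf (-q) q = qPochInf (q ^ 2) (q ^ 2) := by
    refine tendsto_nhds_unique ((tendsto_qPoch q q hq).mul (tendsto_qPoch (-q) q hq)) ?_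
    simpa only [qPoch_mul_qPoch_neg] using tendsto_qPoch (q ^ 2) (q ^ 2) hq2
  have h2 : qPochInf q q = qPochInf q (q ^ 2) * qPochInf (q ^ 2) (q ^ 2) := by
    refine tendsto_nhds_unique ((tendsto_qPoch q q hq).comp
      (tendsto_id.const_mul_atTop' (two_pos : (0 : ℕ) < 2))) ?_
    simpa only [Function.comp_def, id, qPoch_two_mul] using
      (tendsto_qPoch q (q ^ 2) hq2).mul (tendsto_qPoch (q ^ 2) (q ^ 2) hq2)
  have h3 := qPochInf_ne_zero hq2 hq2
  rw [h2] at h1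
  exact mul_right_cancel₀ h3 (by linear_combination h1)

/-! ### Contiguous families of series -/

lemma tsum_sub_tsum_of_telescoping {f f' g : ℕ → ℂ} {c d : ℂ} (hf : Summable f)
    (hf' : Summable f') {l : ℂ} (hg : Tendsto g atTop (𝓝 l)) (h0 : c * f 0 - d * f' 0 = g 0)
    (hs : ∀ k, c * f (k + 1) - d * f' (k + 1) = g (k + 1) - g k) :
    c * ∑' k, f k - d * ∑' k, f' k = l := by
  have h := ((hf.hasSum.mul_left c).sub (hf'.hasSum.mul_left d)).tendsto_sum_nat.comp
    (tendsto_add_atTop_nat 1)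
  refine tendsto_nhds_unique h (hg.congr fun n => ?_)
  induction n with
  | zero => simp [h0]
  | succ n ih =>
    simp only [Function.comp_apply] at ih ⊢
    rw [Finset.sum_range_succ, ← ih, hs]
    ring

lemma tendsto_tsum_of_mul_pow {p : ℂ} (hp : ‖p‖ < 1) {φ : ℂ → ℕ → ℂ} {b : ℕ → ℝ}
    (hb : Summable b) (hφ : ∀ A, ‖A‖ ≤ 1 → ∀ k, ‖φ A k‖ ≤ b k)
    (hcont : ∀ k, ContinuousAt (fun A => φ A k) 0) :
    Tendsto (fun n : ℕ => ∑' k, φ (p ^ n) k) atTop (𝓝 (∑' k, φ 0 k)) := by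
  refine tendsto_tsum_of_dominated_convergence hb (fun k => ?_) (Eventually.of_forall fun n k => ?_)
  · exact (hcont k).tendsto.comp (tendsto_pow_atTop_nhds_zero_of_norm_lt_one hp)
  · exact hφ _ (by rw [norm_pow]; exact pow_le_one₀ (norm_nonneg _) hp.le) k

/-- Iteration of a contiguous relation `c(A) S(A) = d(A) S(Ap)` for `S(A) = ∑ φ(A,k)`, along
`A = 1, p, p², …`. The relation comes from a telescoping certificate `g`. -/
lemma tsum_mul_eq_of_contiguous {p : ℂ} (hp : ‖p‖ < 1) {φ g : ℂ → ℕ → ℂ} {c d : ℂ → ℂ} {C D : ℂ}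
    {b : ℕ → ℝ} (hb : Summable b) (hφ : ∀ A, ‖A‖ ≤ 1 → ∀ k, ‖φ A k‖ ≤ b k)
    (hcont : ∀ k, ContinuousAt (fun A => φ A k) 0)
    (hg : ∀ A, ‖A‖ ≤ 1 → Tendsto (g A) atTop (𝓝 0))
    (h0 : ∀ A, ‖A‖ ≤ 1 → c A * φ A 0 - d A * φ (A * p) 0 = g A 0)
    (hs : ∀ A, ‖A‖ ≤ 1 → ∀ k,
      c A * φ A (k + 1) - d A * φ (A * p) (k + 1) = g A (k + 1) - g A k)
    (hC : Tendsto (fun n => ∏ i ∈ Finset.range n, c (p ^ i)) atTop (𝓝 C))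
    (hD : Tendsto (fun n => ∏ i ∈ Finset.range n, d (p ^ i)) atTop (𝓝 D)) :
    (∑' k, φ 1 k) * C = D * ∑' k, φ 0 k := by
  have hsum : ∀ A, ‖A‖ ≤ 1 → Summable (φ A) := fun A hA => Summable.of_norm_bounded hb (hφ A hA)
  have hpow : ∀ n : ℕ, ‖p ^ n‖ ≤ 1 := fun n => by
    rw [norm_pow]; exact pow_le_one₀ (norm_nonneg _) hp.le
  have hstep : ∀ n : ℕ, c (p ^ n) * ∑' k, φ (p ^ n) k = d (p ^ n) * ∑' k, φ (p ^ (n + 1)) k := by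
    intro n
    refine sub_eq_zero.1 (tsum_sub_tsum_of_telescoping (hsum _ (hpow n)) (hsum _ (hpow _))
      (hg _ (hpow n)) ?_ fun k => ?_)
    · rw [pow_succ]; exact h0 _ (hpow n)
    · rw [pow_succ]; exact hs _ (hpow n) k
  have hiter : ∀ n : ℕ, (∑' k, φ 1 k) * ∏ i ∈ Finset.range n, c (p ^ i) =
      (∏ i ∈ Finset.range n, d (p ^ i)) * ∑' k, φ (p ^ n) k := by
    intro n
    induction n with
    | zero => simp
    | succ n ih =>
      rw [Finset.prod_range_succ, Finset.prod_range_succ, ← mul_assoc, ih]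
      linear_combination (∏ i ∈ Finset.range n, d (p ^ i)) * hstep n
  refine tendsto_nhds_unique (hC.const_mul _) ?_
  simpa only [hiter] using hD.mul (tendsto_tsum_of_mul_pow hp hb hφ hcont)

lemma tendsto_zero_of_norm_le_geometric {g : ℕ → ℂ} {C r : ℝ} (h0 : 0 ≤ r) (h1 : r < 1)
    (h : ∀ k, ‖g k‖ ≤ C * r ^ k) : Tendsto g atTop (𝓝 0) :=
  squeeze_zero_norm h (by simpa using (tendsto_pow_atTop_nhds_zero_of_lt_one h0 h1).const_mul C)

lemma summable_const_mul_geometric {r : ℝ} (h0 : 0 ≤ r) (h1 : r < 1) (C : ℝ) :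
    Summable fun k : ℕ => C * r ^ k := (summable_geometric_of_lt_one h0 h1).mul_left C

/-! ### The theta series `∑ q^{k(k+1)/2}` and its relatives -/

lemma pow_triangle_succ (q : ℂ) (k : ℕ) :
    q ^ ((k + 1) * (k + 1 + 1) / 2) = q ^ (k * (k + 1) / 2) * q ^ (k + 1) := by
  rw [← pow_add]
  congr 1
  rw [show (k + 1) * (k + 1 + 1) = k * (k + 1) + (k + 1) * 2 by ring,
    Nat.add_mul_div_right _ _ two_pos]

lemma norm_pow_triangle_le {q : ℂ} (hq : ‖q‖ < 1) (k : ℕ) :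
    ‖q ^ (k * (k + 1) / 2)‖ ≤ ‖q‖ ^ k := by
  rw [norm_pow]
  refine pow_le_pow_of_le_one (norm_nonneg _) hq.le ?_
  rw [Nat.le_div_iff_mul_le two_pos]
  rcases k with _ | k
  · simp
  · gcongr; omega

lemma norm_pow_triangle_succ_le {q : ℂ} (hq : ‖q‖ < 1) (k : ℕ) :
    ‖q ^ ((k + 1) * (k + 1 + 1) / 2)‖ ≤ ‖q‖ ^ k :=
  (norm_pow_triangle_le hq (k + 1)).trans
    (pow_le_pow_of_le_one (norm_nonneg _) hq.le k.le_succ)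

lemma exists_qPoch_bounds {q : ℂ} (hq : ‖q‖ < 1) : ∃ M δ : ℝ, 0 < M ∧ 0 < δ ∧
    ∀ a p : ℂ, ‖a‖ ≤ ‖q‖ → ‖p‖ ≤ ‖q‖ → ∀ n, ‖qPoch a p n‖ ≤ M ∧ δ ≤ ‖qPoch a p n‖ := by
  obtain ⟨M, hM, h1⟩ := exists_norm_qPoch_le (norm_nonneg q) hq
  obtain ⟨δ, hδ, h2⟩ := exists_le_norm_qPoch (norm_nonneg q) hq
  exact ⟨M, δ, hM, hδ, fun a p ha hp n => ⟨h1 a p n (ha.trans hq.le) hp, h2 a p n ha hp⟩⟩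

lemma norm_one_sub_le_two {z : ℂ} (hz : ‖z‖ ≤ 1) : ‖1 - z‖ ≤ 2 := by
  have := norm_sub_le (1 : ℂ) z
  rw [norm_one] at this
  linarith

/-- Euler's series: `∑ q^{k(k+1)/2} / (q;q)_k = (-q;q)_∞`. -/
lemma tsum_triangle_div_qPoch {q : ℂ} (hq : ‖q‖ < 1) :
    ∑' k : ℕ, q ^ (k * (k + 1) / 2) / qPoch q q k = qPochInf (-q) q := by
  obtain ⟨M, δ, hM, hδ, hb⟩ := exists_qPoch_bounds hq
  have hP : ∀ k, qPoch q q k ≠ 0 := qPoch_ne_zero hq hq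
  have h := tsum_mul_eq_of_contiguous (p := q) (C := 1) (D := qPochInf (-q) q)
    (φ := fun A k => A ^ k * q ^ (k * (k + 1) / 2) / qPoch q q k)
    (g := fun A k => -A ^ (k + 1) * q ^ ((k + 1) * (k + 1 + 1) / 2) / qPoch q q k)
    (c := fun _ => 1) (d := fun A => 1 + A * q)
    hq (summable_const_mul_geometric (norm_nonneg q) hq (1 / δ)) ?_ ?_ ?_ ?_ ?_ ?_ ?_
  · have h0 : ∑' k : ℕ, (0 : ℂ) ^ k * q ^ (k * (k + 1) / 2) / qPoch q q k = 1 := by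
      rw [tsum_eq_single 0 fun k hk => by rw [zero_pow hk, zero_mul, zero_div]]
      simp
    simpa only [one_pow, one_mul, mul_one, h0] using h
  · intro A hA k
    have h1 := norm_pow_triangle_le hq k
    have h2 := (hb q q le_rfl le_rfl k).2
    rw [norm_div, norm_mul, norm_pow A]
    calc _ ≤ 1 ^ k * ‖q‖ ^ k / δ := by gcongr
      _ = _ := by ring
  · intro k
    fun_prop
  · intro A hA
    refine tendsto_zero_of_norm_le_geometric (C := 1 / δ) (norm_nonneg q) hq fun k => ?_
    have h1 := norm_pow_triangle_succ_le hq k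
    have h2 := (hb q q le_rfl le_rfl k).2
    rw [norm_div, norm_mul, norm_neg, norm_pow A]
    calc _ ≤ 1 ^ (k + 1) * ‖q‖ ^ k / δ := by gcongr
      _ = _ := by ring
  · intro A _
    simp
  · intro A _ k
    have h1 := hP k
    have h2 := hP (k + 1)
    rw [qPoch_succ] at h2 ⊢
    have h3 := right_ne_zero_of_mul h2
    simp only [pow_triangle_succ q (k + 1), mul_pow]
    field_simp
    ring
  · simp
  · refine (tendsto_qPoch (-q) q hq).congr fun n => ?_
    exact Finset.prod_congr rfl fun k _ => by ring

/-- Gauss's product `∑ q^{k(k+1)/2} = (q²;q²)_∞ (-q;q)_∞`. It is the case `A = 1` of Lebesgue's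
identity for `∑ (Aq;q)_k q^{k(k+1)/2} / (q;q)_k`. -/
lemma tsum_triangle {q : ℂ} (hq : ‖q‖ < 1) :
    ∑' k : ℕ, q ^ (k * (k + 1) / 2) = qPochInf (q ^ 2) (q ^ 2) * qPochInf (-q) q := by
  obtain ⟨M, δ, hM, hδ, hb⟩ := exists_qPoch_bounds hq
  have hP : ∀ k, qPoch q q k ≠ 0 := qPoch_ne_zero hq hq
  have hq2 : ‖q ^ 2‖ < 1 := norm_pow_lt_one hq two_ne_zero
  have h := tsum_mul_eq_of_contiguous (p := q ^ 2) (C := 1) (D := qPochInf (q ^ 2) (q ^ 2))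
    (φ := fun A k => qPoch (A * q) q k * q ^ (k * (k + 1) / 2) / qPoch q q k)
    (g := fun A k => A * q * qPoch (A * q ^ 2) q k * q ^ ((k + 1) * (k + 1 + 1) / 2) / qPoch q q k)
    (c := fun _ => 1) (d := fun A => 1 - A * q ^ 2)
    hq2 (summable_const_mul_geometric (norm_nonneg q) hq (M / δ)) ?_ ?_ ?_ ?_ ?_ ?_ ?_
  · rw [← tsum_triangle_div_qPoch hq]
    simp only [mul_one, one_mul, zero_mul, qPoch_zero_left] at h
    rw [← h]
    exact tsum_congr fun k => by rw [mul_div_cancel_left₀ _ (hP k)]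
  · intro A hA k
    have h1 := norm_pow_triangle_le hq k
    have h2 := (hb q q le_rfl le_rfl k).2
    have h3 := (hb (A * q) q (norm_mul_le_of_le_one hA le_rfl) le_rfl k).1
    rw [norm_div, norm_mul]
    calc _ ≤ M * ‖q‖ ^ k / δ := by gcongr
      _ = _ := by ring
  · intro k
    exact ContinuousAt.div_const (by fun_prop) _
  · intro A hA
    refine tendsto_zero_of_norm_le_geometric (C := M / δ) (norm_nonneg q) hq fun k => ?_
    have h1 := norm_pow_triangle_succ_le hq k
    have h2 := (hb q q le_rfl le_rfl k).2
    have h3 := (hb (A * q ^ 2) q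
      (norm_mul_le_of_le_one hA (norm_pow_le_self hq two_ne_zero)) le_rfl k).1
    have h4 : ‖A * q‖ ≤ 1 := (norm_mul_le_of_le_one hA le_rfl).trans hq.le
    rw [norm_div, norm_mul, norm_mul]
    calc _ ≤ 1 * M * ‖q‖ ^ k / δ := by gcongr
      _ = _ := by ring
  · intro A _
    simp
    ring
  · intro A _ k
    have h1 := hP k
    have h2 := hP (k + 1)
    rw [qPoch_succ] at h2
    have h3 := right_ne_zero_of_mul h2
    have e1 : qPoch (A * q) q (k + 1) = (1 - A * q) * qPoch (A * q ^ 2) q k := by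
      rw [qPoch_succ', show A * q * q = A * q ^ 2 by ring]
    have e2 : (1 - A * q ^ 2) * qPoch (A * q ^ 2 * q) q (k + 1) =
        qPoch (A * q ^ 2) q k * (1 - A * q ^ 2 * q ^ k) * (1 - A * q ^ 2 * q ^ (k + 1)) := by
      rw [← qPoch_succ', qPoch_succ, qPoch_succ]
    rw [← mul_div_assoc (1 - A * q ^ 2), ← mul_assoc (1 - A * q ^ 2), e2, e1, pow_triangle_succ q (k + 1),
      qPoch_succ, qPoch_succ]
    field_simp
    ring
  · simp
  · refine (tendsto_qPoch (q ^ 2) (q ^ 2) hq2).congr fun n => ?_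
    exact Finset.prod_congr rfl fun k _ => by ring

/-- The case `b = c = q` of Andrews' `q`-analogue of Gauss's second theorem. Shifting `b = Aq`
to `A = 0` reduces it to `tsum_triangle`. -/
lemma tsum_triangle_mul_qPoch_div {q : ℂ} (hq : ‖q‖ < 1) :
    (∑' k : ℕ, qPoch q q k * q ^ (k * (k + 1) / 2) / qPoch (q ^ 3) (q ^ 2) k) *
      qPochInf (q ^ 3) (q ^ 2) = qPochInf (q ^ 2) (q ^ 2) ^ 2 * qPochInf (-q) q := by
  obtain ⟨M, δ, hM, hδ, hb⟩ := exists_qPoch_bounds hq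
  have hq2 : ‖q ^ 2‖ < 1 := norm_pow_lt_one hq two_ne_zero
  have hn : ∀ A : ℂ, ‖A‖ ≤ 1 → ∀ i, i ≠ 0 → ‖A * q ^ i‖ ≤ ‖q‖ := fun A hA i hi =>
    norm_mul_le_of_le_one hA (norm_pow_le_self hq hi)
  have hP : ∀ A : ℂ, ‖A‖ ≤ 1 → ∀ i, i ≠ 0 → ∀ k, qPoch (A * q ^ i) (q ^ 2) k ≠ 0 :=
    fun A hA i hi k => qPoch_ne_zero ((hn A hA i hi).trans_lt hq) hq2 k
  have hp2 : ‖q ^ 2‖ ≤ ‖q‖ := norm_pow_le_self hq two_ne_zero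
  have h := tsum_mul_eq_of_contiguous (p := q ^ 2)
    (C := qPochInf (q ^ 3) (q ^ 2)) (D := qPochInf (q ^ 2) (q ^ 2))
    (φ := fun A k => qPoch (A * q) q k * q ^ (k * (k + 1) / 2) / qPoch (A * q ^ 3) (q ^ 2) k)
    (g := fun A k => A * q * (1 - q ^ (k + 1)) * qPoch (A * q ^ 2) q k *
      q ^ ((k + 1) * (k + 1 + 1) / 2) / qPoch (A * q ^ 5) (q ^ 2) k)
    (c := fun A => 1 - A * q ^ 3) (d := fun A => 1 - A * q ^ 2)
    hq2 (summable_const_mul_geometric (norm_nonneg q) hq (M / δ)) ?_ ?_ ?_ ?_ ?_ ?_ ?_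
  · simp only [one_mul, zero_mul, qPoch_zero_left, div_one, tsum_triangle hq] at h
    rw [h]
    ring
  · intro A hA k
    have h1 := norm_pow_triangle_le hq k
    have h2 := (hb _ _ (hn A hA 3 (by norm_num)) hp2 k).2
    have h3 := (hb (A * q) q (norm_mul_le_of_le_one hA le_rfl) le_rfl k).1
    rw [norm_div, norm_mul]
    calc _ ≤ M * ‖q‖ ^ k / δ := by gcongr
      _ = _ := by ring
  · intro k
    exact ContinuousAt.div (by fun_prop) (by fun_prop) (by simp)
  · intro A hA
    refine tendsto_zero_of_norm_le_geometric (C := 2 * M / δ) (norm_nonneg q) hq fun k => ?_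
    have h1 := norm_pow_triangle_succ_le hq k
    have h2 := (hb _ _ (hn A hA 5 (by norm_num)) hp2 k).2
    have h3 := (hb _ q (hn A hA 2 two_ne_zero) le_rfl k).1
    have h4 : ‖A * q‖ ≤ 1 := (norm_mul_le_of_le_one hA le_rfl).trans hq.le
    have h5 : ‖1 - q ^ (k + 1)‖ ≤ 2 :=
      norm_one_sub_le_two (norm_pow_lt_one hq k.succ_ne_zero).le
    rw [norm_div, norm_mul, norm_mul, norm_mul]
    calc _ ≤ 1 * 2 * M * ‖q‖ ^ k / δ := by gcongr
      _ = _ := by ring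
  · intro A _
    simp
    ring
  · intro A hA k
    have h1 := hP A hA 5 (by norm_num) k
    have h2 := hP A hA 5 (by norm_num) (k + 1)
    have h4 := hP A hA 3 (by norm_num) 1
    rw [qPoch_succ] at h2
    have h3 := right_ne_zero_of_mul h2
    simp only [qPoch_succ, qPoch_zero, one_mul, pow_zero, mul_one] at h4
    have e1 : qPoch (A * q) q (k + 1) = (1 - A * q) * qPoch (A * q ^ 2) q k := by
      rw [qPoch_succ', show A * q * q = A * q ^ 2 by ring]
    have e2 : (1 - A * q ^ 2) * qPoch (A * q ^ 2 * q) q (k + 1) =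
        qPoch (A * q ^ 2) q k * (1 - A * q ^ 2 * q ^ k) * (1 - A * q ^ 2 * q ^ (k + 1)) := by
      rw [← qPoch_succ', qPoch_succ, qPoch_succ]
    have e3 : qPoch (A * q ^ 3) (q ^ 2) (k + 1) = (1 - A * q ^ 3) * qPoch (A * q ^ 5) (q ^ 2) k := by
      rw [qPoch_succ', show A * q ^ 3 * q ^ 2 = A * q ^ 5 by ring]
    rw [← mul_div_assoc (1 - A * q ^ 2), ← mul_assoc (1 - A * q ^ 2), e2, e1, e3,
      pow_triangle_succ q (k + 1), show A * q ^ 2 * q ^ 3 = A * q ^ 5 by ring,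
      qPoch_succ (A * q ^ 5), qPoch_succ (A * q ^ 2)]
    field_simp
    ring
  · refine (tendsto_qPoch (q ^ 3) (q ^ 2) hq2).congr fun n => ?_
    exact Finset.prod_congr rfl fun k _ => by ring
  · refine (tendsto_qPoch (q ^ 2) (q ^ 2) hq2).congr fun n => ?_
    exact Finset.prod_congr rfl fun k _ => by ring

/-! ### A case of Rahman's quadratic summation -/

/-- The case `A = 1` of a contiguous family in which `A = 0` is `tsum_triangle_mul_qPoch_div`. In
Rahman's summation the family is `a = Aq²` with `b = c = q`. -/
lemma summable_and_tsum_quadratic {q : ℂ} (hq : ‖q‖ < 1) :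
    Summable (fun k : ℕ => (1 - q ^ (3 * k + 2)) *
      (qPoch (q ^ 2) (q ^ 2) k * qPoch q q k * qPoch q q k) * q ^ (k * (k + 1) / 2) /
        qPoch (q ^ 3) (q ^ 2) k ^ 3) ∧
    (∑' k : ℕ, (1 - q ^ (3 * k + 2)) *
      (qPoch (q ^ 2) (q ^ 2) k * qPoch q q k * qPoch q q k) * q ^ (k * (k + 1) / 2) /
        qPoch (q ^ 3) (q ^ 2) k ^ 3) * qPochInf (q ^ 3) (q ^ 2) ^ 3 =
      qPochInf (q ^ 2) (q ^ 2) ^ 4 * qPochInf (-q) q := by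
  obtain ⟨M, δ, hM, hδ, hb⟩ := exists_qPoch_bounds hq
  have hq2 : ‖q ^ 2‖ < 1 := norm_pow_lt_one hq two_ne_zero
  have hn : ∀ A : ℂ, ‖A‖ ≤ 1 → ∀ i, i ≠ 0 → ‖A * q ^ i‖ ≤ ‖q‖ := fun A hA i hi =>
    norm_mul_le_of_le_one hA (norm_pow_le_self hq hi)
  have hP : ∀ A : ℂ, ‖A‖ ≤ 1 → ∀ i, i ≠ 0 → ∀ k, qPoch (A * q ^ i) (q ^ 2) k ≠ 0 :=
    fun A hA i hi k => qPoch_ne_zero ((hn A hA i hi).trans_lt hq) hq2 k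
  have hp2 : ‖q ^ 2‖ ≤ ‖q‖ := norm_pow_le_self hq two_ne_zero
  have hp3 : ‖q ^ 3‖ ≤ ‖q‖ := norm_pow_le_self hq three_ne_zero
  have hsum := summable_const_mul_geometric (norm_nonneg q) hq (2 * (M * M * M) / (δ ^ 2 * δ))
  have hbound : ∀ A : ℂ, ‖A‖ ≤ 1 → ∀ k : ℕ, ‖(1 - A * q ^ (3 * k + 2)) *
      (qPoch (A * q ^ 2) (q ^ 2) k * qPoch q q k * qPoch (A * q) q k) * q ^ (k * (k + 1) / 2) /
        (qPoch (A * q ^ 3) (q ^ 2) k ^ 2 * qPoch (q ^ 3) (q ^ 2) k)‖ ≤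
        2 * (M * M * M) / (δ ^ 2 * δ) * ‖q‖ ^ k := by
    intro A hA k
    have h1 := norm_pow_triangle_le hq k
    have h2 := (hb _ _ (hn A hA 3 (by norm_num)) hp2 k).2
    have h3 := (hb (A * q) q (norm_mul_le_of_le_one hA le_rfl) le_rfl k).1
    have h4 := (hb _ _ (hn A hA 2 (by norm_num)) hp2 k).1
    have h5 := (hb q q le_rfl le_rfl k).1
    have h6 := (hb _ _ hp3 hp2 k).2
    have h7 : ‖1 - A * q ^ (3 * k + 2)‖ ≤ 2 :=
      norm_one_sub_le_two ((hn A hA _ (by omega)).trans hq.le)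
    simp only [norm_div, norm_mul, norm_pow _ 2] at *
    calc _ ≤ 2 * (M * M * M) * ‖q‖ ^ k / (δ ^ 2 * δ) := by gcongr
      _ = _ := by ring
  have h := tsum_mul_eq_of_contiguous (p := q ^ 2)
    (C := qPochInf (q ^ 3) (q ^ 2) ^ 2) (D := qPochInf (q ^ 2) (q ^ 2) ^ 2)
    (φ := fun A k => (1 - A * q ^ (3 * k + 2)) *
      (qPoch (A * q ^ 2) (q ^ 2) k * qPoch q q k * qPoch (A * q) q k) * q ^ (k * (k + 1) / 2) /
        (qPoch (A * q ^ 3) (q ^ 2) k ^ 2 * qPoch (q ^ 3) (q ^ 2) k))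
    (g := fun A k => A * q * (1 - A * q ^ 2) * (1 - q ^ (k + 1)) *
      (qPoch (A * q ^ 4) (q ^ 2) k * qPoch q q (k + 1) * qPoch (A * q ^ 2) q k) *
      q ^ ((k + 1) * (k + 1 + 1) / 2) /
        (qPoch (A * q ^ 5) (q ^ 2) k ^ 2 * qPoch (q ^ 3) (q ^ 2) k))
    (c := fun A => (1 - A * q ^ 3) ^ 2) (d := fun A => (1 - A * q ^ 2) ^ 2)
    hq2 hsum hbound ?_ ?_ ?_ ?_ ?_ ?_
  · have hfun : ∀ k : ℕ, (1 - q ^ (3 * k + 2)) *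
        (qPoch (q ^ 2) (q ^ 2) k * qPoch q q k * qPoch q q k) * q ^ (k * (k + 1) / 2) /
        qPoch (q ^ 3) (q ^ 2) k ^ 3 = (1 - 1 * q ^ (3 * k + 2)) *
        (qPoch (1 * q ^ 2) (q ^ 2) k * qPoch q q k * qPoch (1 * q) q k) * q ^ (k * (k + 1) / 2) /
        (qPoch (1 * q ^ 3) (q ^ 2) k ^ 2 * qPoch (q ^ 3) (q ^ 2) k) := by
      intro k
      simp only [one_mul, ← pow_succ]
    simp only [hfun]
    refine ⟨Summable.of_norm_bounded hsum (hbound 1 (by simp)), ?_⟩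
    rw [pow_succ (qPochInf (q ^ 3) (q ^ 2)) 2, ← mul_assoc, h]
    have h' := tsum_triangle_mul_qPoch_div hq
    simp only [zero_mul, qPoch_zero_left, sub_zero, one_mul, one_pow, mul_one]
    linear_combination qPochInf (q ^ 2) (q ^ 2) ^ 2 * h'
  · intro k
    refine ContinuousAt.div (by fun_prop) (by fun_prop) ?_
    simpa using hP 1 (by simp) 3 (by norm_num) k
  · intro A hA
    refine tendsto_zero_of_norm_le_geometric (C := 1 * 2 * 2 * (M * M * M) / (δ ^ 2 * δ))
      (norm_nonneg q) hq fun k => ?_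
    have h1 := norm_pow_triangle_succ_le hq k
    have h2 := (hb _ _ (hn A hA 5 (by norm_num)) hp2 k).2
    have h3 := (hb _ q (hn A hA 2 two_ne_zero) le_rfl k).1
    have h4 : ‖A * q‖ ≤ 1 := (norm_mul_le_of_le_one hA le_rfl).trans hq.le
    have h5 : ‖1 - q ^ (k + 1)‖ ≤ 2 :=
      norm_one_sub_le_two (norm_pow_lt_one hq k.succ_ne_zero).le
    have h6 : ‖1 - A * q ^ 2‖ ≤ 2 := norm_one_sub_le_two ((hn A hA 2 two_ne_zero).trans hq.le)
    have h7 := (hb _ _ (hn A hA 4 (by norm_num)) hp2 k).1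
    have h8 := (hb q q le_rfl le_rfl (k + 1)).1
    have h9 := (hb _ _ hp3 hp2 k).2
    simp only [norm_div, norm_mul, norm_pow _ 2] at *
    calc _ ≤ 1 * 2 * 2 * (M * M * M) * ‖q‖ ^ k / (δ ^ 2 * δ) := by gcongr
      _ = _ := by ring
  · intro A _
    simp [qPoch_succ]
    ring
  · intro A hA k
    have h1 := hP A hA 5 (by norm_num) k
    have h2 := hP A hA 5 (by norm_num) (k + 1)
    have h4 := hP A hA 3 (by norm_num) 1
    have h5 := hP 1 (by simp) 3 (by norm_num) k
    have h6 := hP 1 (by simp) 3 (by norm_num) (k + 1)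
    rw [qPoch_succ] at h2 h6
    rw [one_mul] at h5 h6
    have h3 := right_ne_zero_of_mul h2
    have h7 := right_ne_zero_of_mul h6
    simp only [qPoch_succ, qPoch_zero, one_mul, pow_zero, mul_one] at h4
    have e1 : qPoch (A * q) q (k + 1) = (1 - A * q) * qPoch (A * q ^ 2) q k := by
      rw [qPoch_succ', show A * q * q = A * q ^ 2 by ring]
    have e2 : (1 - A * q ^ 2) * qPoch (A * q ^ 2 * q) q (k + 1) =
        qPoch (A * q ^ 2) q k * (1 - A * q ^ 2 * q ^ k) * (1 - A * q ^ 2 * q ^ (k + 1)) := by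
      rw [← qPoch_succ', qPoch_succ, qPoch_succ]
    have e3 : qPoch (A * q ^ 3) (q ^ 2) (k + 1) = (1 - A * q ^ 3) * qPoch (A * q ^ 5) (q ^ 2) k := by
      rw [qPoch_succ', show A * q ^ 3 * q ^ 2 = A * q ^ 5 by ring]
    have e4 : qPoch (A * q ^ 2) (q ^ 2) (k + 1) = (1 - A * q ^ 2) * qPoch (A * q ^ 4) (q ^ 2) k := by
      rw [qPoch_succ', show A * q ^ 2 * q ^ 2 = A * q ^ 4 by ring]
    -- One factor `1 - A q²` of `d A` completes the shifted product `(A q³; q)`.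
    have e5 : ∀ x y z w s : ℂ, (1 - A * q ^ 2) ^ 2 * (x * (y * z *
        qPoch (A * q ^ 2 * q) q (k + 1)) * w / s) = (1 - A * q ^ 2) * (x * (y * z *
        ((1 - A * q ^ 2) * qPoch (A * q ^ 2 * q) q (k + 1))) * w / s) := by
      intros; ring
    rw [e5, e2, e1, e3, e4, pow_triangle_succ q (k + 1), show A * q ^ 2 * q ^ 3 = A * q ^ 5 by ring,
      show A * q ^ 2 * q ^ 2 = A * q ^ 4 by ring, qPoch_succ (A * q ^ 5), qPoch_succ (A * q ^ 2),
      qPoch_succ (A * q ^ 4), qPoch_succ (q ^ 3), qPoch_succ q q (k + 1)]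
    field_simp
    ring
  · refine ((tendsto_qPoch (q ^ 3) (q ^ 2) hq2).pow 2).congr fun n => ?_
    rw [qPoch, ← Finset.prod_pow]
    exact Finset.prod_congr rfl fun k _ => by ring
  · refine ((tendsto_qPoch (q ^ 2) (q ^ 2) hq2).pow 2).congr fun n => ?_
    rw [qPoch, ← Finset.prod_pow]
    exact Finset.prod_congr rfl fun k _ => by ring

lemma hasSum_quadratic {q : ℂ} (hq : ‖q‖ < 1) :
    HasSum
      (fun n : ℕ =>
        q ^ (n * (n + 1) / 2) * ((1 - q ^ (3 * n + 2)) / (1 - q)) *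
          (qPoch q q n ^ 3 * qPoch (-q) q n / qPoch (q ^ 3) (q ^ 2) n ^ 3))
      ((1 - q) ^ 2 * (qPochInf (q ^ 2) (q ^ 2) ^ 4 / qPochInf q (q ^ 2) ^ 4)) := by
  obtain ⟨hs, ht⟩ := summable_and_tsum_quadratic hq
  have hq2 : ‖q ^ 2‖ < 1 := norm_pow_lt_one hq two_ne_zero
  have h1 : 1 - q ≠ 0 := one_sub_ne_zero_of_norm_lt hq
  have h3 := qPochInf_ne_zero (norm_pow_lt_one hq three_ne_zero) hq2
  have h4 : qPochInf q (q ^ 2) = (1 - q) * qPochInf (q ^ 3) (q ^ 2) := by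
    rw [qPochInf_eq_mul hq2, show q * q ^ 2 = q ^ 3 by ring]
  have hE := qPochInf_neg_mul hq
  rw [h4] at hE ⊢
  have h5 : qPochInf (-q) q = 1 / ((1 - q) * qPochInf (q ^ 3) (q ^ 2)) := by
    rw [eq_div_iff (mul_ne_zero h1 h3), hE]
  have hval : (1 - q) ^ 2 * (qPochInf (q ^ 2) (q ^ 2) ^ 4 /
      ((1 - q) * qPochInf (q ^ 3) (q ^ 2)) ^ 4) = (∑' k : ℕ, (1 - q ^ (3 * k + 2)) *
      (qPoch (q ^ 2) (q ^ 2) k * qPoch q q k * qPoch q q k) * q ^ (k * (k + 1) / 2) /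
        qPoch (q ^ 3) (q ^ 2) k ^ 3) / (1 - q) := by
    rw [(eq_div_iff (pow_ne_zero 3 h3)).2 ht, h5]
    field_simp
  rw [hval]
  refine (hs.hasSum.div_const (1 - q)).congr_fun fun n => ?_
  rw [← qPoch_mul_qPoch_neg]
  ring

/-! ### The accelerated Lambert series -/

/-- Acceleration of the Lambert series by the Wilf–Zeilberger pair `F`, `G`: `∑ₙ F(y,n)` decreases
by `y / (1 - yq)²` when `y` is replaced by `yq²`. -/
lemma summable_and_tsum_lambert {q : ℂ} (hq : ‖q‖ < 1) :
    Summable (fun k : ℕ => q ^ (2 * k) / (1 - q ^ (2 * k + 1)) ^ 2) ∧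
    HasSum (fun n : ℕ => q ^ (2 * n * (n + 1)) * (1 + q ^ (2 * n + 2) - 2 * q ^ (4 * n + 3)) *
        qPoch (q ^ 2) (q ^ 2) n ^ 3 /
        (qPoch q (q ^ 2) (n + 1) ^ 3 * qPoch (-q) q (2 * n + 2)))
      (∑' k : ℕ, q ^ (2 * k) / (1 - q ^ (2 * k + 1)) ^ 2) := by
  obtain ⟨M, δ, hM, hδ, hb⟩ := exists_qPoch_bounds hq
  have hq2 : ‖q ^ 2‖ < 1 := norm_pow_lt_one hq two_ne_zero
  have hp2 : ‖q ^ 2‖ ≤ ‖q‖ := norm_pow_le_self hq two_ne_zero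
  have hyq : ∀ y : ℂ, ‖y‖ ≤ 1 → ‖y * q‖ ≤ ‖q‖ := fun y hy => norm_mul_le_of_le_one hy le_rfl
  have hP : ∀ y : ℂ, ‖y‖ ≤ 1 → ∀ k, qPoch (y * q) (q ^ 2) k ≠ 0 :=
    fun y hy k => qPoch_ne_zero ((hyq y hy).trans_lt hq) hq2 k
  have hPn : ∀ k, qPoch (-q) q k ≠ 0 := qPoch_ne_zero (by simpa using hq) hq
  have hpow : ∀ n : ℕ, ‖(q ^ 2) ^ n‖ ≤ 1 := fun n => by
    rw [norm_pow]; exact pow_le_one₀ (norm_nonneg _) hq2.le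
  have hle : ∀ n : ℕ, ‖q ^ (2 * n * (n + 1))‖ ≤ ‖q‖ ^ n := fun n => by
    rw [norm_pow]
    exact pow_le_pow_of_le_one (norm_nonneg _) hq.le (by nlinarith)
  have hle1 : ∀ n : ℕ, ‖q ^ n‖ ≤ 1 := fun n => by
    rw [norm_pow]; exact pow_le_one₀ (norm_nonneg _) hq.le
  set F : ℂ → ℕ → ℂ := fun y n => y ^ (2 * n + 1) * q ^ (2 * n * (n + 1)) *
    (1 + q ^ (2 * n + 2) - 2 * (y * q ^ (4 * n + 3))) * qPoch (q ^ 2) (q ^ 2) n ^ 3 /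
    (qPoch (y * q) (q ^ 2) (n + 1) ^ 2 * qPoch q (q ^ 2) (n + 1) * qPoch (-q) q (2 * n + 2)) with hF
  set G : ℂ → ℕ → ℂ := fun y n => y ^ (2 * n + 1) * q ^ (2 * n * (n + 1)) *
    qPoch (q ^ 2) (q ^ 2) n ^ 3 /
    (qPoch (y * q) (q ^ 2) (n + 1) ^ 2 * qPoch q (q ^ 2) n * qPoch (-q) q (2 * n)) with hG
  have hsum := summable_const_mul_geometric (norm_nonneg q) hq (4 * M ^ 3 / (δ ^ 2 * δ * δ))
  have hbound : ∀ y, ‖y‖ ≤ 1 → ∀ n, ‖F y n‖ ≤ 4 * M ^ 3 / (δ ^ 2 * δ * δ) * ‖q‖ ^ n := by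
    intro y hy n
    have h1 := hle n
    have h2 := (hb _ _ hp2 hp2 n).1
    have h3 := (hb _ _ (hyq y hy) hp2 (n + 1)).2
    have h4 := (hb q _ le_rfl hp2 (n + 1)).2
    have h5 := (hb (-q) q (by simp) le_rfl (2 * n + 2)).2
    have h6 : ‖y ^ (2 * n + 1)‖ ≤ 1 := by rw [norm_pow]; exact pow_le_one₀ (norm_nonneg _) hy
    have h7 : ‖1 + q ^ (2 * n + 2) - 2 * (y * q ^ (4 * n + 3))‖ ≤ 4 := by
      have a1 := norm_sub_le (1 + q ^ (2 * n + 2)) (2 * (y * q ^ (4 * n + 3)))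
      have a2 := norm_add_le 1 (q ^ (2 * n + 2))
      have a3 := hle1 (2 * n + 2)
      have a4 := norm_mul_le_of_le_one hy (hle1 (4 * n + 3))
      rw [norm_mul 2, RCLike.norm_ofNat] at a1
      rw [norm_one] at a2
      linarith
    simp only [hF]
    rw [norm_div, norm_mul, norm_mul, norm_mul, norm_mul, norm_mul, norm_pow _ 2, norm_pow _ 3]
    calc _ ≤ 1 * ‖q‖ ^ n * 4 * M ^ 3 / (δ ^ 2 * δ * δ) := by gcongr
      _ = _ := by ring
  have hGlim : ∀ y, ‖y‖ ≤ 1 → Tendsto (G y) atTop (𝓝 0) := by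
    intro y hy
    refine tendsto_zero_of_norm_le_geometric (C := M ^ 3 / (δ ^ 2 * δ * δ))
      (norm_nonneg q) hq fun n => ?_
    have h1 := hle n
    have h2 := (hb _ _ hp2 hp2 n).1
    have h3 := (hb _ _ (hyq y hy) hp2 (n + 1)).2
    have h4 := (hb q _ le_rfl hp2 n).2
    have h5 := (hb (-q) q (by simp) le_rfl (2 * n)).2
    have h6 : ‖y ^ (2 * n + 1)‖ ≤ 1 := by rw [norm_pow]; exact pow_le_one₀ (norm_nonneg _) hy
    simp only [hG]
    rw [norm_div, norm_mul, norm_mul, norm_mul, norm_mul, norm_pow _ 2, norm_pow _ 3]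
    calc _ ≤ 1 * ‖q‖ ^ n * M ^ 3 / (δ ^ 2 * δ * δ) := by gcongr
      _ = _ := by ring
  have hFsum : ∀ y, ‖y‖ ≤ 1 → Summable (F y) := fun y hy =>
    Summable.of_norm_bounded hsum (hbound y hy)
  have hwz : ∀ y, ‖y‖ ≤ 1 → ∀ n, F y n - F (y * q ^ 2) n = G y n - G y (n + 1) := by
    intro y hy n
    have h1 : qPoch (y * q * q ^ 2) (q ^ 2) n ≠ 0 := by
      have := hP y hy (n + 1)
      rw [qPoch_succ'] at this
      exact right_ne_zero_of_mul this
    have h0 : 1 - y * q ≠ 0 := one_sub_ne_zero_of_norm_lt ((hyq y hy).trans_lt hq)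
    have h2 : 1 - y * q * (q ^ 2) ^ (n + 1) ≠ 0 := by
      have := hP y hy (n + 1 + 1)
      rw [qPoch_succ] at this
      exact right_ne_zero_of_mul this
    have h3 : qPoch q (q ^ 2) n ≠ 0 := qPoch_ne_zero hq hq2 n
    have h4 : 1 - q * (q ^ 2) ^ n ≠ 0 := by
      have := qPoch_ne_zero hq hq2 (n + 1)
      rw [qPoch_succ] at this
      exact right_ne_zero_of_mul this
    have h5 := hPn (2 * n)
    have h6 : 1 - -q * q ^ (2 * n) ≠ 0 := by
      have := hPn (2 * n + 1)
      rw [qPoch_succ] at this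
      exact right_ne_zero_of_mul this
    have h7 : 1 - -q * q ^ (2 * n + 1) ≠ 0 := by
      have := hPn (2 * n + 1 + 1)
      rw [qPoch_succ] at this
      exact right_ne_zero_of_mul this
    -- Shifting `y` to `yq²` or `n` to `n + 1` only changes the outer factors of `(yq;q²)_{n+1}`.
    have e1 : qPoch (y * q) (q ^ 2) (n + 1) = (1 - y * q) * qPoch (y * q * q ^ 2) (q ^ 2) n :=
      qPoch_succ' _ _ _
    have e2 : qPoch (y * q ^ 2 * q) (q ^ 2) (n + 1) =
        qPoch (y * q * q ^ 2) (q ^ 2) n * (1 - y * q * (q ^ 2) ^ (n + 1)) := by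
      rw [show y * q ^ 2 * q = y * q * q ^ 2 by ring, qPoch_succ]
      ring
    have e3 : qPoch (y * q) (q ^ 2) (n + 1 + 1) = (1 - y * q) *
        (qPoch (y * q * q ^ 2) (q ^ 2) n * (1 - y * q * (q ^ 2) ^ (n + 1))) := by
      rw [qPoch_succ, e1]
      ring
    have e4 : qPoch (-q) q (2 * (n + 1)) = qPoch (-q) q (2 * n + 2) := rfl
    have e5 : q ^ (2 * (n + 1) * (n + 1 + 1)) = q ^ (2 * n * (n + 1)) * (q ^ n) ^ 4 * q ^ 4 := by
      rw [← pow_mul, ← pow_add, ← pow_add]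
      congr 1
      ring
    have p1 : (q ^ 2) ^ n = (q ^ n) ^ 2 := by ring
    have p2 : (q ^ 2) ^ (n + 1) = (q ^ n) ^ 2 * q ^ 2 := by ring
    have p3 : q ^ (2 * n) = (q ^ n) ^ 2 := by ring
    have p4 : q ^ (2 * n + 1) = (q ^ n) ^ 2 * q := by ring
    have p5 : q ^ (2 * n + 2) = (q ^ n) ^ 2 * q ^ 2 := by ring
    have p6 : q ^ (4 * n + 3) = (q ^ n) ^ 4 * q ^ 3 := by ring
    have p7 : (y * q ^ 2) ^ (2 * n + 1) = y ^ (2 * n + 1) * (q ^ n) ^ 4 * q ^ 2 := by ring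
    have p8 : y ^ (2 * (n + 1) + 1) = y ^ (2 * n + 1) * y ^ 2 := by ring
    have e6 : qPoch (-q) q (2 * n + 2) = qPoch (-q) q (2 * n) * (1 - -q * q ^ (2 * n)) *
        (1 - -q * q ^ (2 * n + 1)) := by rw [qPoch_succ, qPoch_succ]
    simp only [hF, hG]
    rw [e4, e5, e3, e2, e1, e6, qPoch_succ q, qPoch_succ (q ^ 2) (q ^ 2) n, p8, p7, p6, p5, p4, p3,
      p2, p1]
    rw [p1] at h4
    rw [p2] at h2
    rw [p3] at h6
    rw [p4] at h7
    clear_value F G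
    generalize q ^ n = X at *
    generalize y ^ (2 * n + 1) = Y
    generalize q ^ (2 * n * (n + 1)) = W
    generalize qPoch (y * q * q ^ 2) (q ^ 2) n = Z at *
    generalize qPoch (q ^ 2) (q ^ 2) n = V
    generalize qPoch q (q ^ 2) n = U at *
    generalize qPoch (-q) q (2 * n) = T at *
    -- The linear factors are kept as atoms until the denominators are cleared.
    generalize hd0 : 1 - y * q = d0 at *
    generalize hd2 : 1 - y * q * (X ^ 2 * q ^ 2) = d2 at *
    generalize hd4 : 1 - q * X ^ 2 = d4 at *
    generalize hd6 : 1 - -q * X ^ 2 = d6 at *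
    generalize hd7 : 1 - -q * (X ^ 2 * q) = d7 at *
    field_simp
    rw [← hd0, ← hd2, ← hd4, ← hd6, ← hd7]
    ring
  have hstep : ∀ y, ‖y‖ ≤ 1 → ∑' n, F y n - ∑' n, F (y * q ^ 2) n = y / (1 - y * q) ^ 2 := by
    intro y hy
    have hy2 : ‖y * q ^ 2‖ ≤ 1 := (norm_mul_le_of_le_one hy hp2).trans hq.le
    have := tsum_sub_tsum_of_telescoping (c := 1) (d := 1) (hFsum y hy) (hFsum _ hy2)
      (g := fun n => G y 0 - G y (n + 1))
      (tendsto_const_nhds.sub ((hGlim y hy).comp (tendsto_add_atTop_nat 1)))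
      (by rw [one_mul, one_mul]; exact hwz y hy 0)
      (fun n => by rw [one_mul, one_mul, hwz y hy (n + 1)]; ring)
    rw [one_mul, one_mul] at this
    rw [this]
    simp [hG, qPoch_succ]
  have hpart : ∀ K : ℕ, ∑ k ∈ Finset.range K, q ^ (2 * k) / (1 - q ^ (2 * k + 1)) ^ 2 =
      ∑' n, F 1 n - ∑' n, F ((q ^ 2) ^ K) n := by
    intro K
    induction K with
    | zero => simp
    | succ K ih =>
      rw [Finset.sum_range_succ, ih, pow_succ (q ^ 2), ← sub_eq_zero]
      have := hstep _ (hpow K)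
      rw [← pow_mul, ← pow_succ] at this
      rw [← this, ← pow_mul]
      ring
  have hlim : Tendsto (fun K : ℕ => ∑' n, F ((q ^ 2) ^ K) n) atTop (𝓝 0) := by
    have := tendsto_tsum_of_mul_pow hq2 hsum hbound fun n => by
      refine ContinuousAt.div (by fun_prop) (by fun_prop) ?_
      have := qPoch_ne_zero hq hq2 (n + 1)
      simpa using ⟨this, hPn _⟩
    simpa [hF] using this
  have hs : Summable fun k : ℕ => q ^ (2 * k) / (1 - q ^ (2 * k + 1)) ^ 2 := by
    refine Summable.of_norm_bounded
      ((summable_geometric_of_lt_one (norm_nonneg q) hq).mul_left (1 / (1 - ‖q‖) ^ 2)) fun k => ?_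
    have h1 : 0 < 1 - ‖q‖ := by linarith
    have h2 : 1 - ‖q‖ ≤ ‖1 - q ^ (2 * k + 1)‖ := by
      have a1 := norm_sub_norm_le 1 (q ^ (2 * k + 1))
      have a2 := norm_pow_le_self hq (2 * k).succ_ne_zero
      rw [norm_one] at a1
      simp only [Nat.succ_eq_add_one] at a2
      linarith
    have h3 : ‖q ^ (2 * k)‖ ≤ ‖q‖ ^ k := by
      rw [norm_pow]
      exact pow_le_pow_of_le_one (norm_nonneg _) hq.le (by omega)
    rw [norm_div, norm_pow _ 2]
    calc _ ≤ ‖q‖ ^ k / (1 - ‖q‖) ^ 2 := by gcongr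
      _ = _ := by ring
  refine ⟨hs, ?_⟩
  have h1 : ∑' k : ℕ, q ^ (2 * k) / (1 - q ^ (2 * k + 1)) ^ 2 = ∑' n, F 1 n := by
    refine tendsto_nhds_unique hs.hasSum.tendsto_sum_nat ?_
    simpa only [hpart, sub_zero] using tendsto_const_nhds.sub hlim
  rw [h1]
  refine (hFsum 1 (by simp)).hasSum.congr_fun fun n => ?_
  simp only [hF, one_pow, one_mul, ← pow_succ]

theorem theorem1p2 (q : ℂ) (hq : ‖q‖ < 1) :
    (Summable (fun n : ℕ => q ^ (2 * n) / (1 - q ^ (2 * n + 1)) ^ 2) ∧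
      HasSum
        (fun n : ℕ =>
          q ^ (2 * n * (n + 1)) * (1 + q ^ (2 * n + 2) - 2 * q ^ (4 * n + 3)) *
            (qPoch (q ^ 2) (q ^ 2) n ^ 3 /
              (qPoch q (q ^ 2) (n + 1) ^ 3 * qPoch (-1) q (2 * n + 3))))
        ((1 / 2 : ℂ) * ∑' n : ℕ, q ^ (2 * n) / (1 - q ^ (2 * n + 1)) ^ 2)) ∧
    HasSum
      (fun n : ℕ =>
        q ^ (n * (n + 1) / 2) * ((1 - q ^ (3 * n + 2)) / (1 - q)) *
          (qPoch q q n ^ 3 * qPoch (-q) q n / qPoch (q ^ 3) (q ^ 2) n ^ 3))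
      ((1 - q) ^ 2 * (qPochInf (q ^ 2) (q ^ 2) ^ 4 / qPochInf q (q ^ 2) ^ 4)) := by
  obtain ⟨h1, h2⟩ := summable_and_tsum_lambert hq
  refine ⟨⟨h1, ?_⟩, hasSum_quadratic hq⟩
  refine (h2.mul_left (1 / 2 : ℂ)).congr_fun fun n => ?_
  rw [qPoch_succ' (-1) q (2 * n + 2), neg_one_mul]
  ring
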